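/- **Setting.** Let $(F,C)$ be a control-flow graph: a directed multigraph with finite node set $F$ (flow-points), $m=|F|$, and an initial flow-point $f_0$ from which all flow-points are reachable. Each $f\in F$ has its own set $\mathrm{Var}(f)$ of $n\ge 1$ variables ($n$ is the same for all $f$). A size-change graph $G:f\to g$ is a bipartite directed graph with source nodes $\mathrm{Var}(f)$ and target nodes $\mathrm{Var}(g)$ in which each arc is labeled strict ($\downarrow$) or non-strict ($\overline{\downarrow}$). An SCT instance $\mathcal G$ annotates every arc $c$ of the control-flow graph from $f$ to $g$ with a size-change graph $G_c:f\to g$. It satisfies SCT if for every infinite path $c_1c_2\dots$ in the control-flow graph, the layered graph $G_{c_1}G_{c_2}\cdots$ contains an infinite directed path (starting at any layer) with infinitely many strict arcs. It is fan-out free if every source node of every $G_c$ has out-degree at most 1. A set $P$ of variables of an SCT instance is a thread preserver if for each of its size-change graphs $G:f\to g$ and each $x\in \mathrm{Var}(f)\cap P$ there is an arc $x\to y$ of $G$ with $y\in P$. Let $B=m\cdot 2^n$. For $f\in F$ let $V_f$ be the set of tuples $\vec v=\langle v_1,v_2,\dots\rangle$ of even length whose odd positions are non-empty sets that form a partition of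 $\mathrm{Var}(f)$ and whose even positions are integers between $0$ and $B$. For $G:f\to g$ and $S\subseteq\mathrm{Var}(f)$ let $\Im(S,G)=\{y\mid x\to y\in G \text{ for some } x\in S\}$, and for $\vec v\in V_f$ and odd $i$ let $\Im_i=\Im_i(\vec v,G)=\Im(v_i,G)\setminus\bigcup_{\mathrm{odd}\ j<i}\Im(v_j,G)$. An odd position $i$ is descending if $|\Im_i|<|v_i|$, or $|\Im_i|=|v_i|$ and $G$ has a strict arc from $v_i$ to $\Im_i$. Define $\mathrm{next}(\vec v,G)\in V_g$ as follows. * (N1) If $i$ is the first descending position and $\Im_i\neq\emptyset$, then $\mathrm{next}(\vec v,G)=\langle \Im_1,v_2,\Im_3,\dots,\Im_i,B,S,B\rangle$, where $S$ is the set of variables of $g$ not occurring up to position $i$; if $S=\emptyset$, the final $S,B$ is omitted. * (N2) If $i$ is the first descending position and $\Im_i=\emptyset$, then $\mathrm{next}(\vec v,G)=\langle \Im_1,v_2,\dots,\Im_{i-2},v_{i-1}-1,S,B\rangle$, where $S$ is the set of variables of $g$ not occurring up to position $i-2$, provided that $i>1$ and $v_{i-1}>0$; otherwise it is undefined. * (N3)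 If no position is descending and $v_i$ is the last position, then $\mathrm{next}(\vec v,G)=\langle \Im_1,v_2,\dots,\Im_{i-1},v_i-1\rangle$ provided that $v_i>0$; otherwise it is undefined. Let $\mathcal R$ be the SCT instance with the same control-flow graph as $\mathcal G$, with $V_f$ as the set of variables of $f$, and where the size-change graph of an arc $c$ from $f$ to $g$ consists of the strict arcs $\vec v\to\mathrm{next}(\vec v,G_c)$, for all $\vec v\in V_f$ such that $\mathrm{next}(\vec v,G_c)$ is defined. **Theorem 4.14.** Suppose that $\mathcal G$ is fan-out free, satisfies SCT, and has a strongly connected control-flow graph. Let $S\subseteq\bigcup_f V_f$ be the closure of $\{\vec v_0\}$, where $\vec v_0=\langle\mathrm{Var}(f_0),B\rangle\in V_{f_0}$, under the partial operators $\mathrm{next}(\cdot,G)$ for all $G\in\mathcal G$. Then: 1. $S$ is a thread preserver of $\mathcal R$. 2. Hence $S$ can be used in place of the maximal thread preserver: $S\cap V_f\ne\emptyset$ for every $f$, and for every well-ordered set $D$ of values, $\rho(f,\sigma)=\min\{\sigma(\vec v)\mid \vec v\in S\cap V_f\}$ (for $f\in F$ and $\sigma:V_f\to D$) is a ranking function of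 $\mathcal R$. That is, $\rho(f,\sigma)>\rho(g,\sigma')$ whenever some arc $c$ from $f$ to $g$ satisfies $\sigma(\vec v)>\sigma'(\vec w)$ for all arcs $\vec v\to\vec w$ of the size-change graph of $c$ in $\mathcal R$. 3. (Companion theorem.) If $C$ is a sink strongly connected component of the directed graph on $S$ with the arcs $\vec v\to\mathrm{next}(\vec v,G)$, $G\in\mathcal G$, then $C$ is a thread preserver of $\mathcal R$. -/

import Mathlib

namespace SizeChange

/-- The two labels of a size-change arc: `strict` for `↓`, `nonstrict` for `↓=`. -/
inductive Label where
  | strict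
  | nonstrict
  deriving DecidableEq

/-- A size-change graph with source variables `X` and target variables `Y`: a bipartite directed
graph whose arcs carry a label. `G x y = some r` means that there is an arc `x → y`, labeled `r`;
`G x y = none` means that there is no arc from `x` to `y`. -/
abbrev SCG (X Y : Type*) := X → Y → Option Label

/-- An SCT instance (annotated control-flow graph): a directed multigraph on the flow-points `F`
with initial point `init`, from which all flow-points are reachable, where each flow-point `f` has
its own set `Var f` of variables and each arc from `f` to `g` is annotated with a size-change graph
with source `f` and target `g`. -/
structure ACG (F : Type*) (Var : F → Type*) where
  /-- the arcs of the control-flow graph -/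
  Arc : F → F → Type*
  /-- the initial flow-point -/
  init : F
  reachable : ∀ f, Relation.ReflTransGen (fun a b => Nonempty (Arc a b)) init f
  /-- the size-change graph annotating an arc -/
  graph : ∀ {f g : F}, Arc f g → SCG (Var f) (Var g)

namespace ACG

variable {F : Type*} {Var : F → Type*}

/-- The control-flow graph is strongly connected. -/
def StronglyConnected (𝒢 : ACG F Var) : Prop :=
  ∀ f g, Relation.ReflTransGen (fun a b => Nonempty (𝒢.Arc a b)) f g

/-- In every size-change graph every source node has out-degree at most one. -/
def FanOutFree (𝒢 : ACG F Var) : Prop :=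
  ∀ ⦃f g : F⦄ (c : 𝒢.Arc f g) (x : Var f) (y y' : Var g),
    𝒢.graph c x y ≠ none → 𝒢.graph c x y' ≠ none → y = y'

/-- An infinite multipath, given by an infinite path in the control-flow graph. -/
structure InfMultipath (𝒢 : ACG F Var) where
  point : ℕ → F
  arc : ∀ i, 𝒢.Arc (point i) (point (i + 1))

/-- An infinite thread of a multipath: an infinite directed path in the layered graph. It may start
at any layer. -/
structure InfThread (𝒢 : ACG F Var) (M : 𝒢.InfMultipath) where
  start : ℕ
  var : ∀ i, Var (M.point (start + i))
  isArc : ∀ i, 𝒢.graph (M.arc (start + i)) (var i) (var (i + 1)) ≠ none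

/-- A thread is infinitely descending if it includes infinitely many strict arcs. -/
def InfThread.InfinitelyDescending {𝒢 : ACG F Var} {M : 𝒢.InfMultipath}
    (τ : 𝒢.InfThread M) : Prop :=
  ∀ N, ∃ i, N ≤ i ∧
    𝒢.graph (M.arc (τ.start + i)) (τ.var i) (τ.var (i + 1)) = some Label.strict

/-- The SCT condition: every infinite multipath contains an infinitely descending thread. -/
def SatisfiesSCT (𝒢 : ACG F Var) : Prop :=
  ∀ M : 𝒢.InfMultipath, ∃ τ : 𝒢.InfThread M, τ.InfinitelyDescending

/-- A set `P` of variables (of all flow-points together) is a thread preserver if, for every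
size-change graph `G : f → g` of the instance, each variable of `f` in `P` has an arc of `G`
leading to some variable of `g` in `P`. -/
def ThreadPreserver (𝒢 : ACG F Var) (P : Set (Σ f, Var f)) : Prop :=
  ∀ ⦃f g : F⦄ (c : 𝒢.Arc f g) (x : Var f), (⟨f, x⟩ : Σ f, Var f) ∈ P →
    ∃ y : Var g, 𝒢.graph c x y ≠ none ∧ (⟨g, y⟩ : Σ f, Var f) ∈ P

end ACG

/-- `G ⊨ (f, σ) ↦ (g, σ')`: the stores `σ`, `σ'` satisfy all the constraints expressed by the arcs
of `G : f → g`. -/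
def Describes {X Y D : Type*} [LinearOrder D] (G : SCG X Y) (σ : X → D) (σ' : Y → D) : Prop :=
  ∀ x y, (G x y = some Label.strict → σ' y < σ x) ∧ (G x y = some Label.nonstrict → σ' y ≤ σ x)

/-- A ranking function for `𝒢` with values in a (well-founded) order `W`: it decreases strictly
along every state transition that is described by a size-change graph of `𝒢`. States are pairs of a
flow-point `f` and a store `Var f → D`. -/
def ACG.IsRankingFunction {F : Type*} {Var : F → Type*} (𝒢 : ACG F Var) {D W : Type*}
    [LinearOrder D] [Preorder W] (ρ : (Σ f, (Var f → D)) → W) : Prop :=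
  ∀ ⦃f g : F⦄ (c : 𝒢.Arc f g) (σ : Var f → D) (σ' : Var g → D),
    Describes (𝒢.graph c) σ σ' → ρ ⟨g, σ'⟩ < ρ ⟨f, σ⟩

section Vectors

/-- Tuples of even length, written as lists of blocks: the block `(s, k)` with (zero-based) index
`j` holds the set-valued odd position `2 j + 1` and the numeric even position `2 j + 2`. -/
abbrev Tuple (X : Type*) := List (Finset X × ℕ)

/-- The set of tuples `V_f^B` for `X = Var(f)`: the sets in the odd positions are non-empty and
form a partition of the set of all variables, the numbers are between `0` and `B`. -/
structure IsVec {X : Type*} (B : ℕ) (v : Tuple X) : Prop where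
  nonempty : ∀ p ∈ v, p.1.Nonempty
  disjoint : v.Pairwise fun p q => Disjoint p.1 q.1
  cover : ∀ x : X, ∃ p ∈ v, x ∈ p.1
  le_bound : ∀ p ∈ v, p.2 ≤ B

/-- `V_f^B`, for `X = Var(f)`. -/
abbrev Vec (X : Type*) (B : ℕ) := {v : Tuple X // IsVec B v}

/-- The vector `⟨Var(f), B⟩`. -/
def topVec (X : Type*) [Fintype X] [Nonempty X] (B : ℕ) : Vec X B :=
  ⟨[(Finset.univ, B)], by simp, by simp, by simp, by simp⟩

variable {X Y : Type*} [DecidableEq Y]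

/-- The set in the odd position of block `j`. -/
def setAt (v : Tuple X) (j : ℕ) : Finset X := (v.getD j (∅, 0)).1

/-- The number in the even position of block `j`. -/
def numAt (v : Tuple X) (j : ℕ) : ℕ := (v.getD j (∅, 0)).2

variable [Fintype Y]

/-- `ℑ(S, G)`: the targets of the arcs of `G` that leave `S`. -/
def image (S : Finset X) (G : SCG X Y) : Finset Y :=
  Finset.univ.filter fun y => ∃ x ∈ S, G x y ≠ none

/-- `ℑ_i(v, G)` for the odd position `i` of block `j`: the image of that set, without the images of
the sets in lower odd positions. -/
def imageAt (v : Tuple X) (G : SCG X Y) (j : ℕ) : Finset Y :=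
  image (setAt v j) G \ (Finset.range j).biUnion fun k => image (setAt v k) G

/-- The odd position of block `j` is descending. -/
def Descending (v : Tuple X) (G : SCG X Y) (j : ℕ) : Prop :=
  (imageAt v G j).card < (setAt v j).card ∨
    ((imageAt v G j).card = (setAt v j).card ∧
      ∃ x ∈ setAt v j, ∃ y ∈ imageAt v G j, G x y = some Label.strict)

instance (v : Tuple X) (G : SCG X Y) (j : ℕ) : Decidable (Descending v G j) := by
  unfold Descending; infer_instance

/-- The blocks with index less than `j`, with each set replaced by its `ℑ_i(v, G)` and all numbers
kept. -/
def prefixImage (v : Tuple X) (G : SCG X Y) (j : ℕ) : Tuple Y :=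
  (List.range j).map fun k => (imageAt v G k, numAt v k)

/-- The target variables that do not occur in the sets of `w`. -/
def rest (w : Tuple Y) : Finset Y := Finset.univ.filter fun y => ∀ p ∈ w, y ∉ p.1

/-- `next(v, G)`, as an optional value; `none` stands for undefined. The three cases are:
* the first descending position belongs to block `j` and its image is non-empty: the image is
  followed by `B` and by the remaining variables, if any, with `B`;
* the first descending position belongs to block `j` and its image is empty: the number of block
  `j - 1` is decremented and the block is followed by the remaining variables, with `B`
  (undefined if there is no such block or its number is `0`);
* no position is descending: the last number is decremented (undefined if it is `0`). -/
def next (B : ℕ) (v : Tuple X) (G : SCG X Y) : Option (Tuple Y) :=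
  match (List.range v.length).find? (fun j => decide (Descending v G j)) with
  | some j =>
    if (imageAt v G j).Nonempty then
      let w := prefixImage v G j ++ [(imageAt v G j, B)]
      if rest w = ∅ then some w else some (w ++ [(rest w, B)])
    else if 0 < j ∧ 0 < numAt v (j - 1) then
      let w := prefixImage v G (j - 1) ++ [(imageAt v G (j - 1), numAt v (j - 1) - 1)]
      some (w ++ [(rest w, B)])
    else none
  | none =>
    let l := v.length - 1
    if 0 < numAt v l then some (prefixImage v G l ++ [(imageAt v G l, numAt v l - 1)]) else none

end Vectors

section Construction

variable {F : Type*} {Var : F → Type*} [∀ f, Fintype (Var f)] [∀ f, DecidableEq (Var f)]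

/-- The SCT instance `ℛ`: the control-flow graph is that of `𝒢`, the variables of `f` are the
vectors `V_f^B`, and the size-change graph of an arc `c` has the strict arcs `v → next(v, G_c)`, for
all `v` such that `next(v, G_c)` exists. -/
def vectorInstance (𝒢 : ACG F Var) (B : ℕ) : ACG F (fun f => Vec (Var f) B) where
  Arc := 𝒢.Arc
  init := 𝒢.init
  reachable := 𝒢.reachable
  graph := fun c v w => if next B v.1 (𝒢.graph c) = some w.1 then some Label.strict else none

/-- `v → next(v, G)` for some size-change graph `G` of `𝒢` whose source is the flow-point of `v`. -/
inductive Step (𝒢 : ACG F Var) (B : ℕ) :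
    (Σ f, Vec (Var f) B) → (Σ f, Vec (Var f) B) → Prop
  | mk {f g : F} (c : 𝒢.Arc f g) (v : Vec (Var f) B) (w : Vec (Var g) B)
      (h : next B v.1 (𝒢.graph c) = some w.1) : Step 𝒢 B ⟨f, v⟩ ⟨g, w⟩

/-- The closure of `{⟨Var(f₀), B⟩}` under `next(·, G)` for all `G` in `𝒢`: the smallest set of
vectors that contains `⟨Var(f₀), B⟩` and, with `v`, every existing `next(v, G)`. -/
inductive Closure (𝒢 : ACG F Var) [Nonempty (Var 𝒢.init)] (B : ℕ) :
    (Σ f, Vec (Var f) B) → Prop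
  | base : Closure 𝒢 B ⟨𝒢.init, topVec (Var 𝒢.init) B⟩
  | step {p q : Σ f, Vec (Var f) B} : Closure 𝒢 B p → Step 𝒢 B p q → Closure 𝒢 B q

/-- `Closure` as a set. -/
def closureSet (𝒢 : ACG F Var) [Nonempty (Var 𝒢.init)] (B : ℕ) : Set (Σ f, Vec (Var f) B) :=
  {p | Closure 𝒢 B p}

end Construction

/-- `C` is a sink strongly connected component of the directed graph with node set `S` and arc
relation `A` (restricted to `S`): it is the class of some node under mutual reachability, and no
arc leaves it. -/
def IsSinkSCC {α : Type*} (S : Set α) (A : α → α → Prop) (C : Set α) : Prop :=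
  let R : α → α → Prop := Relation.ReflTransGen fun a b => a ∈ S ∧ b ∈ S ∧ A a b
  (∃ a ∈ S, C = {b | b ∈ S ∧ R a b ∧ R b a}) ∧
    ∀ a ∈ C, ∀ b ∈ S, A a b → b ∈ C

end SizeChange

/-! The crux is that `next` is never undefined on the closure. As long as blocks do not descend,
fan-out freeness carries their union U along without strict arcs and without change of size. Let a
pair (f, U) precede (g, U') if some path does this from U to U' while every thread from outside U
either dies or enters the carried set (`Cut`). Repeating a cut from a pair to itself would give a
multipath without infinite descent (`not_transGen_cutStep`). So under SCT the cuts form a strict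
partial order on m·2^n = B pairs, and heights stay below B (`cutHeight_lt`).

The numbers of a vector are counters for this order: each decrement of a number below B completes a
cut and so raises the height of the recorded pair (`Recorded.cut_height`). A vector stuck at number
0 would need a height of at least B. A vector stuck because its first set vanishes would give a path
that loses all initial variables, which strong connectivity closes into a forbidden cycle
(`Recorded.next_ne_none`). Since `next` also yields vectors (`IsVec.next`), the closure is a thread
preserver; the same existence of steps serves the sink component. -/

namespace SizeChange

/-! ### Images of the blocks of a vector under a fan-out free graph. -/

section VectorLemmas

variable {X Y : Type*} [Fintype Y]

/-- No node of `X` has two outgoing arcs. -/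
def SCG.FanOutFree (G : SCG X Y) : Prop :=
  ∀ ⦃x : X⦄ ⦃y y' : Y⦄, G x y ≠ none → G x y' ≠ none → y = y'

theorem mem_image {S : Finset X} {G : SCG X Y} {y : Y} :
    y ∈ image S G ↔ ∃ x ∈ S, G x y ≠ none := by
  simp [image]

@[simp]
theorem image_empty (G : SCG X Y) : image ∅ G = ∅ := by
  simp [image]

variable [DecidableEq Y]

theorem setAt_of_length_le {v : Tuple X} {j : ℕ} (h : v.length ≤ j) : setAt v j = ∅ := by
  rw [setAt, List.getD_eq_default _ _ h]

theorem setAt_eq_getElem {v : Tuple X} {j : ℕ} (h : j < v.length) : setAt v j = v[j].1 := by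
  simp [setAt, h]

theorem numAt_eq_getElem {v : Tuple X} {j : ℕ} (h : j < v.length) : numAt v j = v[j].2 := by
  simp [numAt, h]

theorem IsVec.setAt_nonempty {B : ℕ} {v : Tuple X} (hv : IsVec B v) {j : ℕ} (h : j < v.length) :
    (setAt v j).Nonempty := by
  rw [setAt_eq_getElem h]
  exact hv.nonempty _ (List.getElem_mem h)

theorem IsVec.numAt_le {B : ℕ} {v : Tuple X} (hv : IsVec B v) (j : ℕ) : numAt v j ≤ B := by
  by_cases h : j < v.length
  · rw [numAt_eq_getElem h]
    exact hv.le_bound _ (List.getElem_mem h)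
  · rw [numAt, List.getD_eq_default _ _ (not_lt.1 h)]
    exact Nat.zero_le B

theorem IsVec.disjoint_setAt {B : ℕ} {v : Tuple X} (hv : IsVec B v) {i j : ℕ} (h : i < j) :
    Disjoint (setAt v i) (setAt v j) := by
  by_cases hj : j < v.length
  · rw [setAt_eq_getElem hj, setAt_eq_getElem (h.trans hj)]
    exact List.pairwise_iff_getElem.1 hv.disjoint i j (h.trans hj) hj h
  · simp [setAt_of_length_le (not_lt.1 hj)]

theorem disjoint_imageAt {v : Tuple X} {G : SCG X Y} {i j : ℕ} (h : i < j) :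
    Disjoint (imageAt v G i) (imageAt v G j) := by
  rw [Finset.disjoint_left]
  intro y hi hj
  refine (Finset.mem_sdiff.1 hj).2 (Finset.mem_biUnion.2 ⟨i, Finset.mem_range.2 h, ?_⟩)
  exact (Finset.mem_sdiff.1 hi).1

@[simp]
theorem length_prefixImage (v : Tuple X) (G : SCG X Y) (j : ℕ) :
    (prefixImage v G j).length = j := by
  simp [prefixImage]

theorem SCG.FanOutFree.card_image_le {G : SCG X Y} (hG : G.FanOutFree) (S : Finset X) :
    (image S G).card ≤ S.card := by
  classical
  have h : image S G = S.biUnion fun x => Finset.univ.filter fun y => G x y ≠ none := by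
    ext y
    simp [mem_image]
  rw [h]
  refine (Finset.card_biUnion_le_card_mul _ _ 1 fun x _ => ?_).trans_eq (mul_one _)
  refine Finset.card_le_one.2 fun y hy y' hy' => ?_
  exact hG (Finset.mem_filter.1 hy).2 (Finset.mem_filter.1 hy').2

variable [DecidableEq X]

theorem image_biUnion {ι : Type*} (s : Finset ι) (t : ι → Finset X) (G : SCG X Y) :
    image (s.biUnion t) G = s.biUnion fun i => image (t i) G := by
  ext y
  simp only [mem_image, Finset.mem_biUnion]
  constructor
  · rintro ⟨x, ⟨i, hi, hx⟩, h⟩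
    exact ⟨i, hi, x, hx, h⟩
  · rintro ⟨i, hi, x, hx, h⟩
    exact ⟨x, ⟨i, hi, hx⟩, h⟩

/-- The union of the sets in the blocks with index less than `j`. -/
def initialUnion (v : Tuple X) (j : ℕ) : Finset X := (Finset.range j).biUnion (setAt v)

@[simp]
theorem initialUnion_zero (v : Tuple X) : initialUnion v 0 = ∅ := by
  simp [initialUnion]

theorem imageAt_eq_sdiff (v : Tuple X) (G : SCG X Y) (j : ℕ) :
    imageAt v G j = image (setAt v j) G \ image (initialUnion v j) G := by
  rw [imageAt, initialUnion, image_biUnion]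

theorem biUnion_imageAt (v : Tuple X) (G : SCG X Y) (j : ℕ) :
    (Finset.range j).biUnion (imageAt v G) = image (initialUnion v j) G := by
  induction j with
  | zero => simp
  | succ j ih =>
    have h : initialUnion v (j + 1) = setAt v j ∪ initialUnion v j := by
      simp [initialUnion, Finset.range_add_one, Finset.biUnion_insert]
    have h' : image (initialUnion v (j + 1)) G
        = image (setAt v j) G ∪ image (initialUnion v j) G := by
      ext y
      simp only [h, mem_image, Finset.mem_union, or_and_right, exists_or]
    rw [Finset.range_add_one, Finset.biUnion_insert, ih, h', imageAt_eq_sdiff,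
      Finset.sdiff_union_self_eq_union]

theorem card_imageAt_of_not_descending {v : Tuple X} {G : SCG X Y} (hG : G.FanOutFree) {j : ℕ}
    (h : ¬ Descending v G j) : (imageAt v G j).card = (setAt v j).card := by
  refine le_antisymm ?_ (not_lt.1 fun h' => h (Or.inl h'))
  exact (Finset.card_le_card Finset.sdiff_subset).trans (hG.card_image_le _)

/-- Fan-out freeness bounds the full image of block `j` by the size of the block, so without descent
nothing is removed in forming ℑ. A strict arc would then end in ℑ and make the block descending. -/
theorem not_strict_of_not_descending {v : Tuple X} {G : SCG X Y} (hG : G.FanOutFree) {j : ℕ}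
    (h : ¬ Descending v G j) {x : X} (hx : x ∈ setAt v j) (y : Y) :
    G x y ≠ some Label.strict := by
  intro hxy
  have hc := card_imageAt_of_not_descending hG h
  have he : imageAt v G j = image (setAt v j) G :=
    Finset.eq_of_subset_of_card_le Finset.sdiff_subset (hc ▸ hG.card_image_le _)
  refine h (Or.inr ⟨hc, x, hx, y, ?_, hxy⟩)
  rw [he]
  exact mem_image.2 ⟨x, hx, by simp [hxy]⟩

theorem not_strict_of_mem_initialUnion {v : Tuple X} {G : SCG X Y} (hG : G.FanOutFree) {j : ℕ}
    (h : ∀ k < j, ¬ Descending v G k) {x : X} (hx : x ∈ initialUnion v j) (y : Y) :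
    G x y ≠ some Label.strict := by
  obtain ⟨k, hk, hx⟩ := Finset.mem_biUnion.1 hx
  exact not_strict_of_not_descending hG (h k (Finset.mem_range.1 hk)) hx y

theorem mem_initialUnion_length {v : Tuple X} {x : X} :
    x ∈ initialUnion v v.length ↔ ∃ p ∈ v, x ∈ p.1 := by
  simp only [initialUnion, Finset.mem_biUnion, Finset.mem_range]
  constructor
  · rintro ⟨k, hk, hx⟩
    exact ⟨v[k], List.getElem_mem hk, setAt_eq_getElem hk ▸ hx⟩
  · rintro ⟨p, hp, hx⟩
    obtain ⟨k, hk, rfl⟩ := List.getElem_of_mem hp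
    exact ⟨k, hk, (setAt_eq_getElem hk).symm ▸ hx⟩

theorem IsVec.initialUnion_length [Fintype X] {B : ℕ} {v : Tuple X} (hv : IsVec B v) :
    initialUnion v v.length = Finset.univ := by
  ext x
  simp [mem_initialUnion_length, -Prod.exists, hv.cover x]

theorem IsVec.initialUnion_ssubset [Fintype X] {B : ℕ} {v : Tuple X} (hv : IsVec B v) {j : ℕ}
    (h : j < v.length) : initialUnion v j ⊂ Finset.univ := by
  obtain ⟨x, hx⟩ := hv.setAt_nonempty h
  refine (Finset.ssubset_univ_iff).2 fun he => ?_
  have : x ∈ initialUnion v j := he ▸ Finset.mem_univ x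
  obtain ⟨k, hk, hx'⟩ := Finset.mem_biUnion.1 this
  exact Finset.disjoint_left.1 (hv.disjoint_setAt (Finset.mem_range.1 hk)) hx' hx

theorem rest_eq_compl (w : Tuple Y) : rest w = (initialUnion w w.length)ᶜ := by
  ext y
  simp [rest, mem_initialUnion_length]

/-! ### Truncations, and case analysis of `next`. -/

/-- The blocks with index at most `j`, with each set replaced by its `ℑ_i(v, G)`, and with the
number of block `j` replaced by `b`. -/
def truncation (v : Tuple X) (G : SCG X Y) (j b : ℕ) : Tuple Y :=
  prefixImage v G j ++ [(imageAt v G j, b)]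

@[simp]
theorem length_truncation (v : Tuple X) (G : SCG X Y) (j b : ℕ) :
    (truncation v G j b).length = j + 1 := by
  simp [truncation]

section Truncation

variable (v : Tuple X) (G : SCG X Y) (b : ℕ) (t : Tuple Y)

theorem setAt_truncation_append {j k : ℕ} (h : k ≤ j) :
    setAt (truncation v G j b ++ t) k = imageAt v G k := by
  have h1 : k < (truncation v G j b ++ t).length := by simp; omega
  rw [setAt_eq_getElem h1]
  rcases h.lt_or_eq with h | rfl
  · simp [truncation, prefixImage, h]
  · simp [truncation, prefixImage]

theorem numAt_truncation_append_of_lt {j k : ℕ} (h : k < j) :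
    numAt (truncation v G j b ++ t) k = numAt v k := by
  have h1 : k < (truncation v G j b ++ t).length := by simp; omega
  rw [numAt_eq_getElem h1]
  simp [truncation, prefixImage, h]

theorem numAt_truncation_append (j : ℕ) : numAt (truncation v G j b ++ t) j = b := by
  have h1 : j < (truncation v G j b ++ t).length := by simp; omega
  rw [numAt_eq_getElem h1]
  simp [truncation, prefixImage]

theorem setAt_truncation_append_succ (j : ℕ) :
    setAt (truncation v G j b ++ t) (j + 1) = setAt t 0 := by
  rw [setAt, List.getD_append_right _ _ _ _ (length_truncation v G j b).le]
  simp [setAt]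

theorem numAt_truncation_append_succ (j : ℕ) :
    numAt (truncation v G j b ++ t) (j + 1) = numAt t 0 := by
  rw [numAt, List.getD_append_right _ _ _ _ (length_truncation v G j b).le]
  simp [numAt]

/-- The ℑ-sets are the disjointed images, so they have the same unions as the images themselves; up
to `j + 1` the appended `t` does not interfere. -/
theorem initialUnion_truncation_append {j k : ℕ} (h : k ≤ j + 1) :
    initialUnion (truncation v G j b ++ t) k = image (initialUnion v k) G := by
  rw [← biUnion_imageAt, initialUnion]
  refine Finset.biUnion_congr rfl fun i hi => setAt_truncation_append v G b t ?_
  have := Finset.mem_range.1 hi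
  omega

theorem rest_truncation (j : ℕ) :
    rest (truncation v G j b) = (image (initialUnion v (j + 1)) G)ᶜ := by
  have := initialUnion_truncation_append v G b [] (le_refl (j + 1))
  rw [List.append_nil] at this
  rw [rest_eq_compl, length_truncation, this]

end Truncation

/-- The three ways in which `next(v, G)` can be defined. -/
inductive NextCase (B : ℕ) (v : Tuple X) (G : SCG X Y) (w : Tuple Y) : Prop
  | descend (j : ℕ) (hj : j < v.length) (hd : ∀ k < j, ¬ Descending v G k)
      (hne : (imageAt v G j).Nonempty) (t : Tuple Y)
      (ht : (rest (truncation v G j B) = ∅ ∧ t = []) ∨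
        ((rest (truncation v G j B)).Nonempty ∧ t = [(rest (truncation v G j B), B)]))
      (hw : w = truncation v G j B ++ t)
  | vanish (j : ℕ) (hj : j + 1 < v.length) (hd : ∀ k < j + 1, ¬ Descending v G k)
      (he : imageAt v G (j + 1) = ∅) (hnum : 0 < numAt v j)
      (hw : w = truncation v G j (numAt v j - 1) ++
        [(rest (truncation v G j (numAt v j - 1)), B)])
  | stable (j : ℕ) (hj : j + 1 = v.length) (hd : ∀ k < j + 1, ¬ Descending v G k)
      (hnum : 0 < numAt v j) (hw : w = truncation v G j (numAt v j - 1))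

theorem nextCase_of_next_eq_some {B : ℕ} {v : Tuple X} {G : SCG X Y} {w : Tuple Y}
    (hv : v ≠ []) (h : next B v G = some w) : NextCase B v G w := by
  have hl : 0 < v.length := List.length_pos_of_ne_nil hv
  unfold next at h
  split at h
  · rename_i j hj
    rw [List.find?_range_eq_some] at hj
    obtain ⟨-, hjl, hd⟩ := hj
    have hd : ∀ k < j, ¬ Descending v G k := by simpa using hd
    have hjl : j < v.length := by simpa using hjl
    dsimp only at h
    split_ifs at h with h1 h2 h3
    · refine .descend j hjl hd h1 [] (Or.inl ⟨h2, rfl⟩) ?_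
      rw [List.append_nil]
      exact (Option.some.inj h).symm
    · exact .descend j hjl hd h1 _ (Or.inr ⟨Finset.nonempty_iff_ne_empty.2 h2, rfl⟩)
        (Option.some.inj h).symm
    · obtain ⟨i, rfl⟩ := Nat.exists_eq_add_of_lt h3.1
      rw [zero_add] at *
      exact .vanish i hjl hd (Finset.not_nonempty_iff_eq_empty.1 h1) h3.2
        (Option.some.inj h).symm
  · rename_i hj
    rw [List.find?_range_eq_none] at hj
    have hd : ∀ k < v.length, ¬ Descending v G k := by simpa using hj
    obtain ⟨i, hi⟩ := Nat.exists_eq_add_of_lt hl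
    rw [zero_add] at hi
    simp only [hi, Nat.add_sub_cancel] at h hd
    split_ifs at h with h1
    exact .stable i hi.symm hd h1 (Option.some.inj h).symm

/-- The three ways in which `next(v, G)` can be undefined. -/
inductive StuckCase (v : Tuple X) (G : SCG X Y) : Prop
  | first (he : imageAt v G 0 = ∅)
  | vanish (j : ℕ) (hj : j < v.length) (hd : ∀ k < j + 1, ¬ Descending v G k)
      (he : imageAt v G (j + 1) = ∅) (hnum : numAt v j = 0)

theorem stuckCase_of_next_eq_none {B : ℕ} {v : Tuple X} {G : SCG X Y}
    (hv : v ≠ []) (h : next B v G = none) : StuckCase v G := by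
  have hl : 0 < v.length := List.length_pos_of_ne_nil hv
  unfold next at h
  split at h
  · rename_i j hj
    rw [List.find?_range_eq_some] at hj
    obtain ⟨-, hjl, hd⟩ := hj
    have hd : ∀ k < j, ¬ Descending v G k := by simpa using hd
    have hjl : j < v.length := by simpa using hjl
    dsimp only at h
    split_ifs at h with h1 h2 h3
    have he := Finset.not_nonempty_iff_eq_empty.1 h1
    rcases j with _ | i
    · exact .first he
    · exact .vanish i (by omega) hd he (by simpa using h3)
  · rename_i hj
    rw [List.find?_range_eq_none] at hj
    have hd : ∀ k < v.length, ¬ Descending v G k := by simpa using hj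
    obtain ⟨i, hi⟩ := Nat.exists_eq_add_of_lt hl
    rw [zero_add] at hi
    simp only [hi, Nat.add_sub_cancel] at h hd
    split_ifs at h with h1
    -- The default value ∅ past the end of `v` acts as a vanished block, so a failed decrement of
    -- the last number falls under the same case.
    refine .vanish i (by omega) hd ?_ (by simpa using h1)
    rw [imageAt_eq_sdiff, setAt_of_length_le hi.le]
    simp

/-! ### The values of `next` are vectors. -/

/-- A truncation at a block that follows no descending one and has non-empty image becomes a vector
when the remaining variables, if any, are appended. -/
theorem isVec_truncation_append {B : ℕ} {v : Tuple X} {G : SCG X Y} (hG : G.FanOutFree)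
    (hv : IsVec B v) {j b : ℕ} (hj : j < v.length) (hb : b ≤ B)
    (hd : ∀ k < j, ¬ Descending v G k) (hne : (imageAt v G j).Nonempty) {t : Tuple Y}
    (ht : (rest (truncation v G j b) = ∅ ∧ t = []) ∨
      ((rest (truncation v G j b)).Nonempty ∧ t = [(rest (truncation v G j b), B)])) :
    IsVec B (truncation v G j b ++ t) := by
  have hblock : ∀ p ∈ truncation v G j b, p.1.Nonempty ∧ p.2 ≤ B := by
    intro p hp
    simp only [truncation, prefixImage, List.mem_append, List.mem_map, List.mem_range,
      List.mem_singleton] at hp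
    rcases hp with ⟨k, hk, rfl⟩ | rfl
    · refine ⟨?_, hv.numAt_le k⟩
      rw [← Finset.card_pos, card_imageAt_of_not_descending hG (hd k hk)]
      exact Finset.card_pos.2 (hv.setAt_nonempty (hk.trans hj))
    · exact ⟨hne, hb⟩
  have hdisj : (truncation v G j b).Pairwise fun p q => Disjoint p.1 q.1 := by
    rw [truncation, prefixImage, List.pairwise_append]
    refine ⟨?_, by simp, ?_⟩
    · rw [List.pairwise_map]
      exact List.pairwise_lt_range.imp fun h => disjoint_imageAt h
    · intro p hp q hq
      obtain ⟨k, hk, rfl⟩ := List.mem_map.1 hp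
      rw [List.mem_singleton.1 hq]
      exact disjoint_imageAt (List.mem_range.1 hk)
  have hrest : ∀ y, y ∈ rest (truncation v G j b) ↔ ∀ p ∈ truncation v G j b, y ∉ p.1 := by
    simp [rest]
  rcases ht with ⟨h0, rfl⟩ | ⟨h0, rfl⟩
  · rw [List.append_nil]
    refine ⟨fun p hp => (hblock p hp).1, hdisj, fun y => ?_, fun p hp => (hblock p hp).2⟩
    have : y ∉ rest (truncation v G j b) := by simp [h0]
    rw [hrest] at this
    push Not at this
    exact this
  · refine ⟨fun p hp => ?_, ?_, fun y => ?_, fun p hp => ?_⟩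
    · rcases List.mem_append.1 hp with hp | hp
      · exact (hblock p hp).1
      · rw [List.mem_singleton.1 hp]
        exact h0
    · rw [List.pairwise_append]
      refine ⟨hdisj, by simp, fun p hp q hq => ?_⟩
      rw [List.mem_singleton.1 hq, Finset.disjoint_right]
      exact fun y hy => (hrest y).1 hy p hp
    · by_cases hy : y ∈ rest (truncation v G j b)
      · exact ⟨_, List.mem_append_right _ (List.mem_singleton_self _), hy⟩
      · rw [hrest] at hy
        push Not at hy
        obtain ⟨p, hp, hy⟩ := hy
        exact ⟨p, List.mem_append_left _ hp, hy⟩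
    · rcases List.mem_append.1 hp with hp | hp
      · exact (hblock p hp).2
      · rw [List.mem_singleton.1 hp]

/-- Blocks and ℑ-sets are both pairwise disjoint, so the blockwise equalities of size add up. With
equally many variables at source and target, this decides whether any variables remain. -/
theorem card_image_initialUnion {B : ℕ} {v : Tuple X} {G : SCG X Y} (hG : G.FanOutFree)
    (hv : IsVec B v) {j : ℕ} (hd : ∀ k < j, ¬ Descending v G k) :
    (image (initialUnion v j) G).card = (initialUnion v j).card := by
  rw [← biUnion_imageAt, initialUnion, Finset.card_biUnion, Finset.card_biUnion]
  · exact Finset.sum_congr rfl fun k hk =>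
      card_imageAt_of_not_descending hG (hd k (Finset.mem_range.1 hk))
  · intro i _ k _ hik
    rcases hik.lt_or_gt with h | h
    · exact hv.disjoint_setAt h
    · exact (hv.disjoint_setAt h).symm
  · intro i _ k _ hik
    rcases hik.lt_or_gt with h | h
    · exact disjoint_imageAt h
    · exact (disjoint_imageAt h).symm

/-- The operator `next` maps vectors to vectors. -/
theorem IsVec.next [Fintype X] {B : ℕ} {v : Tuple X} {G : SCG X Y} {w : Tuple Y}
    (hG : G.FanOutFree) (hcard : Fintype.card X = Fintype.card Y) (hv : IsVec B v)
    (hne : v ≠ []) (h : next B v G = some w) : IsVec B w := by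
  have hpos : ∀ k < v.length, ¬ Descending v G k → (imageAt v G k).Nonempty := by
    intro k hk hd
    rw [← Finset.card_pos, card_imageAt_of_not_descending hG hd]
    exact Finset.card_pos.2 (hv.setAt_nonempty hk)
  rcases nextCase_of_next_eq_some hne h with
    ⟨j, hj, hd, hi, t, ht, rfl⟩ | ⟨j, hj, hd, he, hnum, rfl⟩ | ⟨j, hj, hd, hnum, rfl⟩
  · exact isVec_truncation_append hG hv hj le_rfl hd hi ht
  · refine isVec_truncation_append hG hv (by omega) ((Nat.sub_le _ _).trans (hv.numAt_le j))
      (fun k hk => hd k (by omega)) (hpos j (by omega) (hd j (by omega))) (Or.inr ⟨?_, rfl⟩)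
    -- Block `j + 1` is non-empty, so the union up to block `j` is proper; its image has the same
    -- size and hence is proper too.
    rw [rest_truncation, ← Finset.card_pos, Finset.card_compl,
      card_image_initialUnion hG hv hd, ← hcard]
    exact Nat.sub_pos_of_lt (Finset.card_lt_card (hv.initialUnion_ssubset hj))
  · rw [← List.append_nil (truncation _ _ _ _)]
    refine isVec_truncation_append hG hv (by omega) ((Nat.sub_le _ _).trans (hv.numAt_le j))
      (fun k hk => hd k (by omega)) (hpos j (by omega) (hd j (by omega))) (Or.inl ⟨?_, rfl⟩)
    rw [rest_truncation, ← Finset.card_eq_zero, Finset.card_compl,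
      card_image_initialUnion hG hv hd, hj, hv.initialUnion_length, ← hcard, Finset.card_univ,
      Nat.sub_self]

end VectorLemmas

/-! ### Cuts and their heights. -/

section Cuts

universe u₁ u₂ u₃

variable {F : Type u₁} {Var : F → Type u₂} [∀ f, Fintype (Var f)] [∀ f, DecidableEq (Var f)]

/-- A transition `(f, U, T) → (g, U', T')` along an arc whose size-change graph has no strict arc
leaving `U`, where `U'` is the image of `U`, and `T'` is the part of the image of `T` outside
`U'`. -/
def CutStep (𝒢 : ACG.{u₁, u₂, u₃} F Var) (p q : Σ f, Finset (Var f) × Finset (Var f)) : Prop :=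
  ∃ c : 𝒢.Arc p.1 q.1, (∀ x ∈ p.2.1, ∀ y, 𝒢.graph c x y ≠ some Label.strict) ∧
    q.2.1 = image p.2.1 (𝒢.graph c) ∧ q.2.2 = image p.2.2 (𝒢.graph c) \ q.2.1

theorem exists_seq_of_transGen {α : Type*} {r : α → α → Prop} {a b : α}
    (h : Relation.TransGen r a b) :
    ∃ (n : ℕ) (s : ℕ → α), s 0 = a ∧ s (n + 1) = b ∧ ∀ i ≤ n, r (s i) (s (i + 1)) := by
  induction h with
  | @single b h => exact ⟨0, fun i => if i = 0 then a else b, by simp, by simp, by simpa using h⟩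
  | @tail b c _ hbc ih =>
    obtain ⟨n, s, h0, hn, hs⟩ := ih
    refine ⟨n + 1, fun i => if i ≤ n + 1 then s i else c, by simpa using h0, by simp, ?_⟩
    intro i hi
    rcases hi.lt_or_eq with hi | rfl
    · have h1 : i ≤ n := by omega
      simpa [h1, show i ≤ n + 1 by omega] using hs i h1
    · simpa [hn] using hbc

/-- If all variables outside `U` are lost along a cycle that preserves `U` without strict arcs
leaving `U`, then repeating the cycle yields a multipath without an infinitely descending
thread. -/
theorem not_transGen_cutStep {𝒢 : ACG.{u₁, u₂, u₃} F Var} (hsct : 𝒢.SatisfiesSCT) (f : F)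
    (U : Finset (Var f)) : ¬ Relation.TransGen (CutStep 𝒢) ⟨f, U, Uᶜ⟩ ⟨f, U, ∅⟩ := by
  intro h
  obtain ⟨n, s, h0, hn, hs⟩ := exists_seq_of_transGen h
  -- The path is read modulo `n + 1`, with the final (f, U, ∅) replaced by the initial (f, U, Uᶜ).
  -- This weakens the equation for the last component to an inclusion; the final clause keeps the
  -- fact that nothing is left at a wrap-around.
  have hstep : ∀ i, ∃ c : 𝒢.Arc (s (i % (n + 1))).1 (s ((i + 1) % (n + 1))).1,
      (∀ x ∈ (s (i % (n + 1))).2.1, ∀ y, 𝒢.graph c x y ≠ some Label.strict) ∧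
      (s ((i + 1) % (n + 1))).2.1 = image (s (i % (n + 1))).2.1 (𝒢.graph c) ∧
      (image (s (i % (n + 1))).2.2 (𝒢.graph c) \ (s ((i + 1) % (n + 1))).2.1 ⊆
        (s ((i + 1) % (n + 1))).2.2) ∧
      ((i + 1) % (n + 1) = 0 →
        image (s (i % (n + 1))).2.2 (𝒢.graph c) \ (s ((i + 1) % (n + 1))).2.1 = ∅) := by
    intro i
    have hlt : i % (n + 1) < n + 1 := Nat.mod_lt _ n.succ_pos
    have hmod : (i + 1) % (n + 1) = (i % (n + 1) + 1) % (n + 1) := by simp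
    rw [hmod]
    generalize i % (n + 1) = k at hlt
    obtain ⟨c, hc, hU, hT⟩ := hs k (by omega)
    rcases (Nat.lt_succ_iff.1 hlt).lt_or_eq with hk | rfl
    · rw [Nat.mod_eq_of_lt (by omega : k + 1 < n + 1)]
      exact ⟨c, hc, hU, hT.symm.subset, by omega⟩
    · rw [Nat.mod_self]
      generalize s (k + 1) = q at hn c
      subst hn
      rw [h0]
      refine ⟨c, hc, hU, ?_, fun _ => hT.symm⟩
      rw [← hT]
      exact Finset.empty_subset _
  choose c hc hU hT hreset using hstep
  obtain ⟨τ, hτ⟩ := hsct ⟨fun i => (s (i % (n + 1))).1, c⟩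
  have hmem : ∀ i (S : Finset (Var (s ((τ.start + i) % (n + 1))).1)), τ.var i ∈ S →
      τ.var (i + 1) ∈ image S (𝒢.graph (c (τ.start + i))) := fun i S hS =>
    mem_image.2 ⟨_, hS, τ.isArc i⟩
  -- A thread that enters the carried set stays there and meets no strict arc any more.
  have hnot : ∀ i, τ.var i ∉ (s ((τ.start + i) % (n + 1))).2.1 := by
    intro i hi
    have hall : ∀ k, τ.var (i + k) ∈ (s ((τ.start + (i + k)) % (n + 1))).2.1 := by
      intro k
      induction k with
      | zero => exact hi
      | succ k ih =>
        have h1 := hmem _ _ ih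
        rw [← hU] at h1
        exact h1
    obtain ⟨k, hk, hstrict⟩ := hτ i
    obtain ⟨d, rfl⟩ := Nat.exists_eq_add_of_le hk
    exact hc _ _ (hall d) _ hstrict
  -- The offset `n * τ.start` reaches layer `(n + 1) * τ.start`, the start of a period, where being
  -- outside U means being in the tracked set Uᶜ.
  have hin : ∀ k, τ.var (n * τ.start + k) ∈
      (s ((τ.start + (n * τ.start + k)) % (n + 1))).2.2 := by
    intro k
    induction k with
    | zero =>
      have h1 : (τ.start + (n * τ.start + 0)) % (n + 1) = 0 := by
        rw [show τ.start + (n * τ.start + 0) = (n + 1) * τ.start by ring]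
        exact Nat.mul_mod_right _ _
      have h2 := hnot (n * τ.start + 0)
      revert h2
      generalize τ.var (n * τ.start + 0) = x
      revert x
      dsimp only
      rw [h1, h0]
      exact fun x hx => Finset.mem_compl.2 hx
    | succ k ih =>
      exact hT _ (Finset.mem_sdiff.2 ⟨hmem _ _ ih, hnot (n * τ.start + k + 1)⟩)
  -- After `n` more layers comes the last arc of the period, which no tracked variable survives.
  have h1 := hreset (τ.start + (n * τ.start + n)) (by
    rw [show τ.start + (n * τ.start + n) + 1 = (n + 1) * (τ.start + 1) by ring]
    exact Nat.mul_mod_right _ _)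
  have h2 := Finset.mem_sdiff.2 ⟨hmem _ _ (hin n), hnot (n * τ.start + n + 1)⟩
  exact Finset.notMem_empty _ (h1.subset h2)

/-- There is a path along which `a` is carried to `b` without strict arcs leaving it, and along
which all variables outside `a` are lost. -/
def Cut (𝒢 : ACG.{u₁, u₂, u₃} F Var) (a b : Σ f, Finset (Var f)) : Prop :=
  Relation.TransGen (CutStep 𝒢) ⟨a.1, a.2, a.2ᶜ⟩ ⟨b.1, b.2, ∅⟩

/-- After the first path nothing is left outside the carried set, and the empty set remains empty
along the second. -/
theorem Cut.trans {𝒢 : ACG.{u₁, u₂, u₃} F Var} {a b c : Σ f, Finset (Var f)}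
    (hab : Cut 𝒢 a b) (hbc : Cut 𝒢 b c) : Cut 𝒢 a c := by
  refine Relation.TransGen.trans hab (Relation.TransGen.lift (r := CutStep 𝒢) (p := CutStep 𝒢)
    (fun p => (⟨p.1, p.2.1, ∅⟩ : Σ f, Finset (Var f) × Finset (Var f))) ?_ _ _ hbc)
  rintro p q ⟨e, he, hU, -⟩
  exact ⟨e, he, hU, by simp⟩

theorem Cut.irrefl {𝒢 : ACG.{u₁, u₂, u₃} F Var} (hsct : 𝒢.SatisfiesSCT)
    (a : Σ f, Finset (Var f)) : ¬ Cut 𝒢 a a :=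
  not_transGen_cutStep hsct a.1 a.2

/-- The number of predecessors in the relation `Cut`. -/
noncomputable def cutHeight (𝒢 : ACG.{u₁, u₂, u₃} F Var) (a : Σ f, Finset (Var f)) : ℕ :=
  {b | Cut 𝒢 b a}.ncard

/-- Predecessors of `a` precede `b` by transitivity, and `a` itself is a new predecessor by
irreflexivity. -/
theorem Cut.height_lt [Finite F] {𝒢 : ACG.{u₁, u₂, u₃} F Var} (hsct : 𝒢.SatisfiesSCT)
    {a b : Σ f, Finset (Var f)} (h : Cut 𝒢 a b) : cutHeight 𝒢 a < cutHeight 𝒢 b :=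
  Set.ncard_lt_ncard ⟨fun _ hc => Cut.trans hc h, fun hs => Cut.irrefl hsct a (hs h)⟩
    (Set.toFinite _)

/-- A pair is not its own predecessor, so its height is less than the number of all pairs; this
explains the choice of B. -/
theorem cutHeight_lt [Fintype F] {𝒢 : ACG.{u₁, u₂, u₃} F Var} (hsct : 𝒢.SatisfiesSCT) {n : ℕ}
    (hn : ∀ f, Fintype.card (Var f) = n) (a : Σ f, Finset (Var f)) :
    cutHeight 𝒢 a < Fintype.card F * 2 ^ n := by
  have h : Nat.card (Σ f, Finset (Var f)) = Fintype.card F * 2 ^ n := by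
    simp [Nat.card_eq_fintype_card, Fintype.card_sigma, Fintype.card_finset, hn]
  rw [← h, ← Set.ncard_univ]
  exact Set.ncard_lt_ncard
    ⟨Set.subset_univ _, fun hs => Cut.irrefl hsct a (hs (Set.mem_univ a))⟩ (Set.toFinite _)

/-! ### The history invariant of the closure. -/

/-- The history recorded in a reachable vector: the first set contains all that is left of the
initial variables, and a number below `B` in block `j` is justified by the height of some cut `a`,
such that the variables outside `a` are found in the sets up to block `j + 1`. -/
structure Recorded (𝒢 : ACG.{u₁, u₂, u₃} F Var) (B : ℕ) (f : F) (v : Tuple (Var f)) : Prop where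
  first : Relation.ReflTransGen (CutStep 𝒢) ⟨𝒢.init, ∅, Finset.univ⟩ ⟨f, ∅, setAt v 0⟩
  count : ∀ j < v.length, numAt v j = B ∨ ∃ a : Σ f, Finset (Var f),
    B ≤ numAt v j + cutHeight 𝒢 a + 1 ∧ Relation.ReflTransGen (CutStep 𝒢)
      ⟨a.1, a.2, a.2ᶜ⟩ ⟨f, initialUnion v (j + 1), setAt v (j + 1)⟩

variable {𝒢 : ACG.{u₁, u₂, u₃} F Var} {B : ℕ} {f g : F} {v : Tuple (Var f)}

theorem ACG.FanOutFree.graph (hfan : 𝒢.FanOutFree) (c : 𝒢.Arc f g) :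
    SCG.FanOutFree (𝒢.graph c) :=
  fun x y y' => hfan c x y y'

/-- Removing the images of earlier blocks is exactly how `CutStep` updates its tracked set. Block
`j` itself may descend or vanish. -/
theorem cutStep_of_not_descending (hfan : 𝒢.FanOutFree) (c : 𝒢.Arc f g) {j : ℕ}
    (hd : ∀ k < j, ¬ Descending v (𝒢.graph c) k) :
    CutStep 𝒢 ⟨f, initialUnion v j, setAt v j⟩
      ⟨g, image (initialUnion v j) (𝒢.graph c), imageAt v (𝒢.graph c) j⟩ :=
  ⟨c, fun _ hx y => not_strict_of_mem_initialUnion (hfan.graph c) hd hx y, rfl,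
    imageAt_eq_sdiff _ _ _⟩

theorem Recorded.next_ne_none [Fintype F] (hconn : 𝒢.StronglyConnected) (hfan : 𝒢.FanOutFree)
    (hsct : 𝒢.SatisfiesSCT) {n : ℕ} (hn : ∀ f, Fintype.card (Var f) = n)
    (hB : B = Fintype.card F * 2 ^ n) (hv : Recorded 𝒢 B f v) (hne : v ≠ []) (c : 𝒢.Arc f g) :
    next B v (𝒢.graph c) ≠ none := by
  intro h
  rcases stuckCase_of_next_eq_none hne h with ⟨he⟩ | ⟨j, hj, hd, he, hnum⟩
  · have hstep := cutStep_of_not_descending (v := v) hfan c (j := 0) (by simp)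
    rw [he, initialUnion_zero, image_empty] at hstep
    -- Empty sets stay empty along every path, so the return to the initial point is free.
    have hback : ∀ q, Relation.ReflTransGen (fun a b => Nonempty (𝒢.Arc a b)) g q →
        Relation.ReflTransGen (CutStep 𝒢) ⟨g, ∅, ∅⟩ ⟨q, ∅, ∅⟩ := by
      intro q hq
      refine Relation.ReflTransGen.lift
        (fun q => (⟨q, ∅, ∅⟩ : Σ f, Finset (Var f) × Finset (Var f))) ?_ _ _ hq
      rintro a b ⟨e⟩
      exact ⟨e, by simp, by simp, by simp⟩
    have hloop := (Relation.TransGen.tail' hv.first hstep).trans_left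
      (hback _ (hconn g 𝒢.init))
    rw [← Finset.compl_empty] at hloop
    exact not_transGen_cutStep hsct _ _ hloop
  · have hBpos : 0 < B := by
      rw [hB]
      have := Fintype.card_pos_iff.2 ⟨f⟩
      positivity
    rcases hv.count j hj with h | ⟨a, ha, hpath⟩
    · omega
    · have hstep := cutStep_of_not_descending hfan c hd
      rw [he] at hstep
      have hcut : Cut 𝒢 a ⟨g, image (initialUnion v (j + 1)) (𝒢.graph c)⟩ :=
        Relation.TransGen.tail' hpath hstep
      have h1 := hcut.height_lt hsct
      have h2 := cutHeight_lt hsct hn ⟨g, image (initialUnion v (j + 1)) (𝒢.graph c)⟩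
      omega

/-- A truncation keeps the record of the blocks that are left unchanged. -/
theorem Recorded.of_truncation (hfan : 𝒢.FanOutFree) (hv : Recorded 𝒢 B f v) (c : 𝒢.Arc f g)
    {j b : ℕ} (hj : j < v.length) (hd : ∀ k < j, ¬ Descending v (𝒢.graph c) k)
    {t : Tuple (Var g)}
    (h : ∀ k < (truncation v (𝒢.graph c) j b ++ t).length, j ≤ k →
      numAt (truncation v (𝒢.graph c) j b ++ t) k = B ∨ ∃ a : Σ f, Finset (Var f),
        B ≤ numAt (truncation v (𝒢.graph c) j b ++ t) k + cutHeight 𝒢 a + 1 ∧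
        Relation.ReflTransGen (CutStep 𝒢) ⟨a.1, a.2, a.2ᶜ⟩
          ⟨g, initialUnion (truncation v (𝒢.graph c) j b ++ t) (k + 1),
            setAt (truncation v (𝒢.graph c) j b ++ t) (k + 1)⟩) :
    Recorded 𝒢 B g (truncation v (𝒢.graph c) j b ++ t) := by
  refine ⟨?_, fun k hk => ?_⟩
  · have hstep := cutStep_of_not_descending (v := v) hfan c (j := 0) (by simp)
    rw [setAt_truncation_append _ _ _ _ (Nat.zero_le j)]
    rw [initialUnion_zero, image_empty] at hstep
    exact hv.first.tail hstep
  · by_cases hkj : j ≤ k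
    · exact h k hk hkj
    · have hkj := not_le.1 hkj
      rw [numAt_truncation_append_of_lt _ _ _ _ hkj,
        initialUnion_truncation_append _ _ _ _ (by omega), setAt_truncation_append _ _ _ _ hkj]
      refine (hv.count k (hkj.trans hj)).imp_right ?_
      rintro ⟨a, ha, hpath⟩
      exact ⟨a, ha, hpath.tail (cutStep_of_not_descending hfan c fun i hi => hd i (by omega))⟩

/-- The loss of block `j + 1` completes a cut from the recorded pair to the current one, and the
gain in height pays for the decrement. A number still equal to B needs no payment. -/
theorem Recorded.cut_height [Finite F] (hfan : 𝒢.FanOutFree) (hsct : 𝒢.SatisfiesSCT)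
    (hv : Recorded 𝒢 B f v) (c : 𝒢.Arc f g) {j : ℕ} (hj : j < v.length)
    (hd : ∀ k < j + 1, ¬ Descending v (𝒢.graph c) k)
    (he : imageAt v (𝒢.graph c) (j + 1) = ∅) (hnum : 0 < numAt v j) :
    B ≤ numAt v j - 1 + cutHeight 𝒢 ⟨g, image (initialUnion v (j + 1)) (𝒢.graph c)⟩ + 1 := by
  rcases hv.count j hj with h | ⟨a, ha, hpath⟩
  · omega
  · have hstep := cutStep_of_not_descending hfan c hd
    rw [he] at hstep
    have hcut : Cut 𝒢 a ⟨g, image (initialUnion v (j + 1)) (𝒢.graph c)⟩ :=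
      Relation.TransGen.tail' hpath hstep
    have h1 := hcut.height_lt hsct
    omega

/-- Earlier blocks extend their history by one cut step. From the truncation on, a number is either
set to B or decremented, and a decrement starts a new history at the current pair. -/
theorem Recorded.next [Finite F] (hfan : 𝒢.FanOutFree) (hsct : 𝒢.SatisfiesSCT)
    (hv : Recorded 𝒢 B f v) (hne : v ≠ []) (c : 𝒢.Arc f g) {w : Tuple (Var g)}
    (hw : IsVec B w) (h : next B v (𝒢.graph c) = some w) : Recorded 𝒢 B g w := by
  rcases nextCase_of_next_eq_some hne h with
    ⟨j, hj, hd, hi, t, ht, rfl⟩ | ⟨j, hj, hd, he, hnum, rfl⟩ | ⟨j, hj, hd, hnum, rfl⟩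
  · refine hv.of_truncation hfan c hj hd fun k hk hjk => Or.inl ?_
    rcases hjk.lt_or_eq with hjk | rfl
    · rcases ht with ⟨-, rfl⟩ | ⟨-, rfl⟩
      · simp at hk
        omega
      · simp at hk
        obtain rfl : k = j + 1 := by omega
        rw [numAt_truncation_append_succ]
        rfl
    · exact numAt_truncation_append _ _ _ _ _
  · refine hv.of_truncation hfan c (by omega) (fun k hk => hd k (by omega)) fun k hk hjk => ?_
    rcases hjk.lt_or_eq with hjk | rfl
    · simp at hk
      obtain rfl : k = j + 1 := by omega
      rw [numAt_truncation_append_succ]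
      exact Or.inl rfl
    -- The appended set is the complement of the new pair's set, so the new history is the empty
    -- path.
    · refine Or.inr ⟨⟨g, image (initialUnion v (j + 1)) (𝒢.graph c)⟩, ?_, ?_⟩
      · rw [numAt_truncation_append]
        exact hv.cut_height hfan hsct c (by omega) hd he hnum
      · rw [initialUnion_truncation_append _ _ _ _ le_rfl, setAt_truncation_append_succ,
          ← rest_truncation]
        exact .refl
  · rw [← List.append_nil (truncation _ _ _ _)] at hw ⊢
    refine hv.of_truncation hfan c (by omega) (fun k hk => hd k (by omega)) fun k hk hjk => ?_
    obtain rfl : k = j := by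
      simp at hk
      omega
    have he : imageAt v (𝒢.graph c) (k + 1) = ∅ := by
      rw [imageAt_eq_sdiff, setAt_of_length_le hj.ge]
      simp
    -- The sets of `w` cover everything, so the complement of the new pair's set is ∅, which is also
    -- the default set after the last block.
    have hu := hw.initialUnion_length
    rw [List.append_nil, length_truncation] at hu
    refine Or.inr ⟨⟨g, image (initialUnion v (k + 1)) (𝒢.graph c)⟩, ?_, ?_⟩
    · rw [numAt_truncation_append]
      exact hv.cut_height hfan hsct c (by omega) hd he hnum
    · rw [setAt_truncation_append_succ, ← initialUnion_truncation_append v _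
        (numAt v k - 1) [] le_rfl, List.append_nil, hu, Finset.compl_univ]
      exact .refl

theorem IsVec.ne_nil {X : Type*} [Nonempty X] {v : Tuple X} (hv : IsVec B v) : v ≠ [] := by
  rintro rfl
  obtain ⟨p, hp, -⟩ := hv.cover (Classical.arbitrary X)
  simp at hp

theorem recorded_of_closure [Finite F] [∀ f, Nonempty (Var f)] (hfan : 𝒢.FanOutFree)
    (hsct : 𝒢.SatisfiesSCT) {p : Σ f, Vec (Var f) B} (hp : Closure 𝒢 B p) :
    Recorded 𝒢 B p.1 p.2.1 := by
  induction hp with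
  | base =>
    refine ⟨.refl, fun j hj => Or.inl ?_⟩
    obtain rfl : j = 0 := by simpa [topVec] using hj
    rfl
  | step _ hs ih =>
    obtain ⟨c, v, w, h⟩ := hs
    exact ih.next hfan hsct v.2.ne_nil c w.2 h

theorem exists_step [Fintype F] [∀ f, Nonempty (Var f)] (hconn : 𝒢.StronglyConnected)
    (hfan : 𝒢.FanOutFree) (hsct : 𝒢.SatisfiesSCT) {n : ℕ}
    (hn : ∀ f, Fintype.card (Var f) = n) (hB : B = Fintype.card F * 2 ^ n) {v : Vec (Var f) B}
    (hv : Closure 𝒢 B ⟨f, v⟩) (c : 𝒢.Arc f g) :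
    ∃ w : Vec (Var g) B, next B v.1 (𝒢.graph c) = some w.1 := by
  obtain ⟨w, hw⟩ := Option.ne_none_iff_exists'.1 ((recorded_of_closure hfan hsct hv).next_ne_none
    hconn hfan hsct hn hB v.2.ne_nil c)
  exact ⟨⟨w, v.2.next (hfan.graph c) ((hn f).trans (hn g).symm) v.2.ne_nil hw⟩, hw⟩

end Cuts

/-! ### Ranking function and conclusion. -/

/-- The minimum of a store over a thread preserver that meets every flow-point is a ranking
function, if all arcs are strict. -/
theorem ACG.ThreadPreserver.exists_isRankingFunction {F : Type*} {V : F → Type*} {ℛ : ACG F V}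
    {P : Set (Σ f, V f)} (hP : ℛ.ThreadPreserver P)
    (hstrict : ∀ ⦃f g : F⦄ (c : ℛ.Arc f g) x y, ℛ.graph c x y ≠ none →
      ℛ.graph c x y = some Label.strict)
    (hne : ∀ f, ∃ v, (⟨f, v⟩ : Σ f, V f) ∈ P) (D : Type*) [LinearOrder D] [WellFoundedLT D] :
    ∃ ρ : (Σ f, (V f → D)) → D,
      (∀ s, IsLeast (s.2 '' {v | ⟨s.1, v⟩ ∈ P}) (ρ s)) ∧ ℛ.IsRankingFunction ρ := by
  have hmin : ∀ s : Σ f, (V f → D), ∃ d, IsLeast (s.2 '' {v | ⟨s.1, v⟩ ∈ P}) d := fun s =>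
    have h : (s.2 '' {v | ⟨s.1, v⟩ ∈ P}).Nonempty := Set.Nonempty.image s.2 (hne s.1)
    ⟨_, wellFounded_lt.min_mem _ h, fun _ hx => WellFounded.min_le wellFounded_lt hx⟩
  choose ρ hρ using hmin
  refine ⟨ρ, hρ, fun f g c σ σ' hd => ?_⟩
  obtain ⟨v, hv, hvρ⟩ := (hρ ⟨f, σ⟩).1
  obtain ⟨w, hvw, hw⟩ := hP c v hv
  rw [← hvρ]
  exact ((hρ ⟨g, σ'⟩).2 ⟨w, hw, rfl⟩).trans_lt ((hd v w).1 (hstrict c v w hvw))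

end SizeChange

theorem theorem4p14 {F : Type*} [Fintype F] {Var : F → Type*}
    [∀ f, Fintype (Var f)] [∀ f, DecidableEq (Var f)] [∀ f, Nonempty (Var f)]
    (n : ℕ) (hn : ∀ f, Fintype.card (Var f) = n)
    (𝒢 : SizeChange.ACG F Var)
    (hconn : 𝒢.StronglyConnected) (hfan : 𝒢.FanOutFree) (hsct : 𝒢.SatisfiesSCT)
    (B : ℕ) (hB : B = Fintype.card F * 2 ^ n) :
    -- the closure is a thread preserver of the vector instance
    (SizeChange.vectorInstance 𝒢 B).ThreadPreserver (SizeChange.closureSet 𝒢 B) ∧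
    -- it can be used for a ranking function: it has a vector at every flow-point, and taking
    -- the minimum over it gives a ranking function of the vector instance
    (∀ f, ∃ v, (⟨f, v⟩ : Σ f, SizeChange.Vec (Var f) B) ∈ SizeChange.closureSet 𝒢 B) ∧
    (∀ (D : Type*) [LinearOrder D] [WellFoundedLT D],
      ∃ ρ : (Σ f, (SizeChange.Vec (Var f) B → D)) → D,
        (∀ s, IsLeast (s.2 '' {v | ⟨s.1, v⟩ ∈ SizeChange.closureSet 𝒢 B}) (ρ s)) ∧
        (SizeChange.vectorInstance 𝒢 B).IsRankingFunction ρ) ∧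
    -- any sink strongly connected component of the reachability graph is a thread preserver
    (∀ C, SizeChange.IsSinkSCC (SizeChange.closureSet 𝒢 B) (SizeChange.Step 𝒢 B) C →
      (SizeChange.vectorInstance 𝒢 B).ThreadPreserver C) := by
  have hnext : ∀ {f g : F} (c : 𝒢.Arc f g) (v : SizeChange.Vec (Var f) B),
      SizeChange.Closure 𝒢 B ⟨f, v⟩ →
      ∃ w, (SizeChange.vectorInstance 𝒢 B).graph c v w ≠ none ∧
        SizeChange.Step 𝒢 B ⟨f, v⟩ ⟨g, w⟩ := by
    intro f g c v hv
    obtain ⟨w, hw⟩ := SizeChange.exists_step hconn hfan hsct hn hB hv c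
    exact ⟨w, by simp [SizeChange.vectorInstance, hw], .mk c v w hw⟩
  have hpres : (SizeChange.vectorInstance 𝒢 B).ThreadPreserver
      (SizeChange.closureSet 𝒢 B) := by
    intro f g c v hv
    obtain ⟨w, hvw, hs⟩ := hnext c v hv
    exact ⟨w, hvw, SizeChange.Closure.step hv hs⟩
  have hmeets : ∀ f, ∃ v, (⟨f, v⟩ : Σ f, SizeChange.Vec (Var f) B) ∈
      SizeChange.closureSet 𝒢 B := by
    intro f
    induction 𝒢.reachable f with
    | refl => exact ⟨_, .base⟩
    | tail _ h ih =>
      obtain ⟨c⟩ := h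
      obtain ⟨v, hv⟩ := ih
      obtain ⟨w, -, hw⟩ := hpres c v hv
      exact ⟨w, hw⟩
  refine ⟨hpres, hmeets, fun D _ _ => hpres.exists_isRankingFunction ?_ hmeets D, ?_⟩
  · intro f g c v w h
    simp only [SizeChange.vectorInstance] at h ⊢
    split_ifs at h ⊢
    · rfl
    · exact absurd rfl h
  -- Steps exist everywhere on the closure, and none of them leaves a sink component.
  · rintro C ⟨⟨a, -, rfl⟩, hsink⟩ f g c v hv
    obtain ⟨w, hvw, hs⟩ := hnext c v hv.1
    exact ⟨w, hvw, hsink _ hv _ (SizeChange.Closure.step hv.1 hs) hs⟩
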